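/- For $i\in\{1,2\}$ let $H_i,G_i$ be real Hilbert spaces, $C_i\subset H_i$ closed and convex, $L_i\colon H_i\to G_i$ bounded linear with closed range, $e_i\in H_i$, $b_i=L_ie_i$, and $S_i=\{x\in C_i : L_ix=b_i\}$. Let $\chi>0$ and let $f\colon H_1\oplus H_2\to\mathbb R$ be differentiable with $\chi$-Lipschitz gradient, $f(\cdot,z_2)$ convex for every $z_2\in H_2$ and $f(z_1,\cdot)$ concave for every $z_1\in H_1$. Suppose that $\operatorname{int}(C_i-e_i)\cap\ker L_i\neq\emptyset$ for $i=1,2$, and that there is a Nash equilibrium, i.e. a pair $(x_1,x_2)\in S_1\times S_2$ such that $x_1$ minimizes $f(\cdot,x_2)$ over $S_1$ and $x_2$ maximizes $f(x_1,\cdot)$ over $S_2$. Write $P_C$ for the projection onto a nonempty closed convex set $C$, $L^*$ for the adjoint of $L$ and, for a bounded linear operator $T$ with closed range, let $T^\dagger y$ be the element of least norm of $\{x : T^*Tx=T^*y\}$ (generalized Moore–Penrose inverse). Put $Q_i=L_i^*(L_i^*)^\dagger$. Let $\varepsilon\in(0,1)$, $\gamma\in(0,1/\chi)$, $\lambda_n\in[\varepsilon,1]$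 for $n\in\mathbb N$, let $(z_{1,0},z_{2,0})\in H_1\oplus H_2$ be arbitrary and iterate, for every $n\in\mathbb N$ and with each line carried out for $i=1,2$: $$\begin{aligned} u_{i,n}&=z_{i,n}-Q_iz_{i,n},\\ g_{1,n}&=(\mathrm{Id}-Q_1)\nabla\big(f(\cdot,e_2+u_{2,n})\big)(e_1+u_{1,n}),\quad g_{2,n}=-(\mathrm{Id}-Q_2)\nabla\big(f(e_1+u_{1,n},\cdot)\big)(e_2+u_{2,n}),\\ r_{i,n}&=z_{i,n}-\gamma g_{i,n},\\ p_{i,n}&=P_{C_i}(r_{i,n}+e_i)-e_i,\\ v_{i,n}&=p_{i,n}-Q_ip_{i,n},\\ s_{i,n}&=2v_{i,n}-p_{i,n}+Q_ir_{i,n},\\ h_{1,n}&=(\mathrm{Id}-Q_1)\nabla\big(f(\cdot,e_2+v_{2,n})\big)(e_1+v_{1,n}),\quad h_{2,n}=-(\mathrm{Id}-Q_2)\nabla\big(f(e_1+v_{1,n},\cdot)\big)(e_2+v_{2,n}),\\ t_{i,n}&=s_{i,n}-\gamma h_{i,n},\\ z_{i,n+1}&=z_{i,n}+\lambda_n(t_{i,n}-r_{i,n}).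 \end{aligned}$$ Then there exist a Nash equilibrium $(\bar x_1,\bar x_2)$ and points $\bar w_i\in H_i$ such that, for $i=1,2$, $u_{i,n}+e_i\rightharpoonup\bar x_i$ and $z_{i,n}+e_i\rightharpoonup\bar w_i+e_i$ weakly, where $\bar x_i=(\bar w_i-Q_i\bar w_i)+e_i$. -/

import Mathlib

open Set Filter Topology
open scoped InnerProductSpace Gradient

noncomputable section

/-- `IsProjOn C x p`: the point `p` belongs to `C` and minimizes the distance to `x` over `C`. -/
def IsProjOn {H : Type*} [NormedAddCommGroup H] (C : Set H) (x p : H) : Prop :=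
  p ∈ C ∧ ∀ y ∈ C, ‖x - p‖ ≤ ‖x - y‖

open Classical in
/-- The projection `P_C x` of `x` onto `C`: the minimizer over `C` of the distance to `x`.
It exists and is unique if `C` is a nonempty closed convex subset of a Hilbert space
(see `isProjOn_iff_eq_projOn`); where no minimizer exists the value is `0`. -/
def projOn {H : Type*} [NormedAddCommGroup H] (C : Set H) (x : H) : H :=
  if h : ∃ p, IsProjOn C x p then h.choose else 0

theorem isProjOn_iff_eq_projOn {H : Type*} [NormedAddCommGroup H] [InnerProductSpace ℝ H]
    [CompleteSpace H] {C : Set H} (hne : C.Nonempty) (hcl : IsClosed C) (hcv : Convex ℝ C)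
    (x p : H) : IsProjOn C x p ↔ p = projOn C x := by
  have key : ∀ q, IsProjOn C x q → ∀ w ∈ C, ⟪x - q, w - q⟫_ℝ ≤ 0 := by
    intro q hq
    rw [← norm_eq_iInf_iff_real_inner_le_zero hcv hq.1]
    have : Nonempty C := hne.to_subtype
    refine le_antisymm (le_ciInf fun w => hq.2 w w.2) ?_
    exact ciInf_le ⟨0, Set.forall_mem_range.2 fun _ => norm_nonneg _⟩ (⟨q, hq.1⟩ : C)
  have ex : ∃ q, IsProjOn C x q := by
    obtain ⟨v, hv, hveq⟩ := exists_norm_eq_iInf_of_complete_convex hne hcl.isComplete hcv x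
    refine ⟨v, hv, fun y hy => ?_⟩
    rw [hveq]
    exact ciInf_le ⟨0, Set.forall_mem_range.2 fun _ => norm_nonneg _⟩ (⟨y, hy⟩ : C)
  have spec : IsProjOn C x (projOn C x) := by
    unfold projOn
    rw [dif_pos ex]
    exact ex.choose_spec
  constructor
  · intro hp
    have h1 := key p hp _ spec.1
    have h2 := key _ spec p hp.1
    have h3 : ⟪p - projOn C x, p - projOn C x⟫_ℝ
        = ⟪x - p, projOn C x - p⟫_ℝ + ⟪x - projOn C x, p - projOn C x⟫_ℝ := by
      simp only [inner_sub_left, inner_sub_right]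
      ring
    have h4 : ⟪p - projOn C x, p - projOn C x⟫_ℝ ≤ 0 := by linarith
    rw [real_inner_self_eq_norm_sq] at h4
    exact sub_eq_zero.1 (norm_eq_zero.1 (pow_eq_zero_iff (two_ne_zero) |>.1 (le_antisymm h4 (sq_nonneg _))))
  · rintro rfl
    exact spec

/-- The generalized Moore-Penrose inverse `T†` of a bounded linear operator `T` (with closed
range): `T† y` is the element of minimal norm, that is, the projection of `0`, in
`{x | T* T x = T* y}`. -/
def moorePenrose {H G : Type*} [NormedAddCommGroup H] [InnerProductSpace ℝ H] [CompleteSpace H]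
    [NormedAddCommGroup G] [InnerProductSpace ℝ G] [CompleteSpace G] (T : H →L[ℝ] G) (y : G) : H :=
  projOn {x : H | T.adjoint (T x) = T.adjoint y} 0

/-- The map `L* ∘ (L*)†` on the domain of `L`. -/
def adjMP {H G : Type*} [NormedAddCommGroup H] [InnerProductSpace ℝ H] [CompleteSpace H]
    [NormedAddCommGroup G] [InnerProductSpace ℝ G] [CompleteSpace G] (L : H →L[ℝ] G) (x : H) : H :=
  L.adjoint (moorePenrose L.adjoint x)

/-- The strategy set `C ∩ {x | L x = b}`. -/
def strategySet {H G : Type*} [NormedAddCommGroup H] [InnerProductSpace ℝ H]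
    [NormedAddCommGroup G] [InnerProductSpace ℝ G] (C : Set H) (L : H →L[ℝ] G) (b : G) : Set H :=
  {x ∈ C | L x = b}

/-- `(x₁, x₂)` is a Nash equilibrium of the zero-sum game on `S₁ × S₂` in which the first player
minimizes and the second player maximizes `f`. -/
def IsNashEquilibrium {H₁ H₂ : Type*} (f : WithLp 2 (H₁ × H₂) → ℝ) (S₁ : Set H₁) (S₂ : Set H₂)
    (x₁ : H₁) (x₂ : H₂) : Prop :=
  x₁ ∈ S₁ ∧ x₂ ∈ S₂ ∧
    IsMinOn (fun y₁ => f (WithLp.toLp 2 (y₁, x₂))) S₁ x₁ ∧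
    IsMaxOn (fun y₂ => f (WithLp.toLp 2 (x₁, y₂))) S₂ x₂

/-- The gradient of `f(·, x₂)` at `x₁`. -/
def gradFst {H₁ H₂ : Type*} [NormedAddCommGroup H₁] [InnerProductSpace ℝ H₁] [CompleteSpace H₁]
    (f : WithLp 2 (H₁ × H₂) → ℝ) (x₁ : H₁) (x₂ : H₂) : H₁ :=
  ∇ (fun y₁ => f (WithLp.toLp 2 (y₁, x₂))) x₁

/-- The gradient of `f(x₁, ·)` at `x₂`. -/
def gradSnd {H₁ H₂ : Type*} [NormedAddCommGroup H₂] [InnerProductSpace ℝ H₂] [CompleteSpace H₂]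
    (f : WithLp 2 (H₁ × H₂) → ℝ) (x₁ : H₁) (x₂ : H₂) : H₂ :=
  ∇ (fun y₂ => f (WithLp.toLp 2 (x₁, y₂))) x₂

/-- Weak convergence of the sequence `x` to `a`. -/
def WeaklyConverges {H : Type*} [NormedAddCommGroup H] [InnerProductSpace ℝ H]
    (x : ℕ → H) (a : H) : Prop :=
  Tendsto (fun n => toWeakSpace ℝ H (x n)) atTop (𝓝 (toWeakSpace ℝ H a))

end

/-! Because `L_i` has closed range, `Q_i` projects orthogonally onto the complement of `V_i = ker
L_i`, so `Id - Q_i` is the projection `P_i` onto `V_i`. After translation by `e_i`, an equilibrium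
is a point of `V_1 × V_2` solving a variational inequality for the saddle operator `B = (∇_1 f, -∇_2
f)` over the `C_i - e_i`; convexity-concavity makes `B` monotone, and `B` is `χ`-Lipschitz.

The subspace constraint is absorbed by Spingarn's partial inverse: if `A` is the normal cone
operator of the sets `C_i - e_i`, its partial inverse `A_V` is maximally monotone, with resolvent
`J` computed from `P_C` and `P_i`. With `D = γ P B P`, a monotone map of Lipschitz constant `γχ <
1`, the iteration is exactly Tseng's relaxed forward-backward-forward method for `0 ∈ A_V w + D w`,
and it converges weakly to some `w` with `J (w - D w) = w`.

Such a `w` yields the equilibrium `P w + e` (`variational_of_partialInverseResolvent_eq`).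
Conversely, an equilibrium yields such a `w` (`exists_partialInverseResolvent_eq`); here the
interior condition supplies a multiplier in the complement of `V_i`. -/

/-! ### Weak convergence and Opial's lemma. -/

theorem weaklyConverges_iff_tendsto_inner {H : Type*} [NormedAddCommGroup H]
    [InnerProductSpace ℝ H] [CompleteSpace H] {x : ℕ → H} {a : H} :
    WeaklyConverges x a ↔ ∀ y : H, Tendsto (fun n => ⟪y, x n⟫_ℝ) atTop (𝓝 ⟪y, a⟫_ℝ) := by
  have hinj : Function.Injective (topDualPairing ℝ H).flip := by
    intro u v huv
    refine ext_inner_left ℝ fun w => ?_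
    simpa using! DFunLike.congr_fun huv (InnerProductSpace.toDual ℝ H w)
  refine (WeakBilin.tendsto_iff_forall_eval_tendsto (B := (topDualPairing ℝ H).flip)
    hinj).trans ⟨fun h y => ?_, fun h φ => ?_⟩
  · simpa using! h (InnerProductSpace.toDual ℝ H y)
  · obtain ⟨y, rfl⟩ := (InnerProductSpace.toDual ℝ H).surjective φ
    simpa using! h y

/-- A bounded family in a Hilbert space has a weak limit along every ultrafilter. -/
theorem exists_weak_limit_of_norm_le {H ι : Type*} [NormedAddCommGroup H]
    [InnerProductSpace ℝ H] [CompleteSpace H] (U : Ultrafilter ι) {z : ι → H} {R : ℝ}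
    (hz : ∀ i, ‖z i‖ ≤ R) :
    ∃ w : H, ∀ y : H, Tendsto (fun i => ⟪y, z i⟫_ℝ) U (𝓝 ⟪y, w⟫_ℝ) := by
  -- Banach-Alaoglu, transported by the Riesz isomorphism. With ultrafilters in place of
  -- subsequences, no separability is needed.
  have hcpt := WeakDual.isCompact_closedBall (𝕜 := ℝ) (E := H) 0 R
  set φ : ι → WeakDual ℝ H := fun i =>
    StrongDual.toWeakDual (InnerProductSpace.toDual ℝ H (z i)) with hφ
  have hmem : ∀ i, φ i ∈ WeakDual.toStrongDual ⁻¹' Metric.closedBall (0 : StrongDual ℝ H) R := by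
    intro i
    simpa [hφ] using! hz i
  obtain ⟨ψ, -, hψ⟩ := hcpt.ultrafilter_le_nhds' (U.map φ)
    (Filter.Eventually.of_forall (f := (U : Filter ι)) hmem)
  obtain ⟨w, hw⟩ := (InnerProductSpace.toDual ℝ H).surjective (WeakDual.toStrongDual ψ)
  refine ⟨w, fun y => ?_⟩
  have h1 : Tendsto φ U (𝓝 ψ) := hψ
  have h2 := ((WeakDual.eval_continuous y).tendsto ψ).comp h1
  have h3 : ψ y = ⟪w, y⟫_ℝ := by
    have := DFunLike.congr_fun hw y
    simpa using! this.symm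
  rw [h3, real_inner_comm] at h2
  refine h2.congr fun i => ?_
  simp only [Function.comp, hφ]
  rw [real_inner_comm]
  rfl

/-- **Opial's lemma**. -/
theorem exists_weak_limit_of_fejer {H : Type*} [NormedAddCommGroup H]
    [InnerProductSpace ℝ H] [CompleteSpace H] {S : Set H} (hS : S.Nonempty) {z : ℕ → H}
    (hfejer : ∀ x ∈ S, Antitone fun n => ‖z n - x‖)
    (hcluster : ∀ (U : Ultrafilter ℕ) (w : H), (U : Filter ℕ) ≤ atTop →
      (∀ y : H, Tendsto (fun n => ⟪y, z n⟫_ℝ) U (𝓝 ⟪y, w⟫_ℝ)) → w ∈ S) :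
    ∃ w ∈ S, ∀ y : H, Tendsto (fun n => ⟪y, z n⟫_ℝ) atTop (𝓝 ⟪y, w⟫_ℝ) := by
  obtain ⟨x₀, hx₀⟩ := hS
  have hbd : ∀ n, ‖z n‖ ≤ ‖z 0 - x₀‖ + ‖x₀‖ := fun n =>
    calc ‖z n‖ = ‖(z n - x₀) + x₀‖ := by rw [sub_add_cancel]
      _ ≤ ‖z n - x₀‖ + ‖x₀‖ := norm_add_le _ _
      _ ≤ ‖z 0 - x₀‖ + ‖x₀‖ := by gcongr; exact hfejer x₀ hx₀ (Nat.zero_le n)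
  have hlim : ∀ x ∈ S, ∃ l : ℝ, Tendsto (fun n => ‖z n - x‖ ^ 2) atTop (𝓝 l) := by
    intro x hx
    exact ⟨_, (tendsto_atTop_ciInf (hfejer x hx)
      ⟨0, Set.forall_mem_range.2 fun _ => norm_nonneg _⟩).pow 2⟩
  have huniq : ∀ (U U' : Ultrafilter ℕ) (w w' : H), (U : Filter ℕ) ≤ atTop →
      (U' : Filter ℕ) ≤ atTop →
      (∀ y : H, Tendsto (fun n => ⟪y, z n⟫_ℝ) U (𝓝 ⟪y, w⟫_ℝ)) →
      (∀ y : H, Tendsto (fun n => ⟪y, z n⟫_ℝ) U' (𝓝 ⟪y, w'⟫_ℝ)) → w = w' := by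
    intro U U' w w' hU hU' hw hw'
    obtain ⟨l, hl⟩ := hlim w (hcluster U w hU hw)
    obtain ⟨l', hl'⟩ := hlim w' (hcluster U' w' hU' hw')
    -- The difference of the squared distances to `w'` and `w` is affine in `z n`, so `⟪w - w', z
    -- n⟫` converges along the whole sequence and both cluster points give it the same limit.
    have hdiff := ((hl'.sub hl).add_const (‖w‖ ^ 2 - ‖w'‖ ^ 2)).const_mul (1 / 2 : ℝ)
    have hconv : Tendsto (fun n => ⟪w - w', z n⟫_ℝ) atTop
        (𝓝 (1 / 2 * (l' - l + (‖w‖ ^ 2 - ‖w'‖ ^ 2)))) := by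
      refine hdiff.congr fun n => ?_
      rw [norm_sub_sq_real, norm_sub_sq_real, inner_sub_left, real_inner_comm w,
        real_inner_comm w']
      ring
    have e1 := tendsto_nhds_unique (hconv.mono_left hU) (hw (w - w'))
    have e2 := tendsto_nhds_unique (hconv.mono_left hU') (hw' (w - w'))
    have e3 : ⟪w - w', w - w'⟫_ℝ = 0 := by
      rw [inner_sub_right, ← e1, ← e2, sub_self]
    exact sub_eq_zero.1 (inner_self_eq_zero.1 e3)
  obtain ⟨w, hw⟩ := exists_weak_limit_of_norm_le (Ultrafilter.of (atTop : Filter ℕ)) hbd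
  refine ⟨w, hcluster _ w (Ultrafilter.of_le _) hw, fun y => ?_⟩
  rw [tendsto_iff_ultrafilter]
  intro U hU
  obtain ⟨w', hw'⟩ := exists_weak_limit_of_norm_le U hbd
  rw [huniq _ U w w' (Ultrafilter.of_le _) hU hw hw']
  exact hw' y

/-! ### Tseng's splitting method. -/

/-- **Tseng's forward-backward-forward algorithm**, with relaxation. Here `J` is the resolvent of
a maximally monotone operator and `D` is a monotone contraction. -/
theorem exists_weak_limit_forward_backward_forward {H : Type*} [NormedAddCommGroup H]
    [InnerProductSpace ℝ H] [CompleteSpace H] {J D : H → H}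
    (hJ : ∀ x y, 0 ≤ ⟪(x - J x) - (y - J y), J x - J y⟫_ℝ)
    (hD : ∀ x y, 0 ≤ ⟪D x - D y, x - y⟫_ℝ) {κ : ℝ} (hκ₀ : 0 ≤ κ) (hκ₁ : κ < 1)
    (hDlip : ∀ x y, ‖D x - D y‖ ≤ κ * ‖x - y‖) (hsol : ∃ x, J (x - D x) = x)
    {ε : ℝ} (hε : 0 < ε) {lam : ℕ → ℝ} (hlam : ∀ n, lam n ∈ Icc ε 1) {z s : ℕ → H}
    (hs : ∀ n, s n = J (z n - D (z n)))
    (hz : ∀ n, z (n + 1) = z n + lam n • ((s n - D (s n)) - (z n - D (z n)))) :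
    ∃ w, J (w - D w) = w ∧ ∀ y, Tendsto (fun n => ⟪y, z n⟫_ℝ) atTop (𝓝 ⟪y, w⟫_ℝ) := by
  have hκ2 : 0 < 1 - κ ^ 2 := by nlinarith
  have hstep : ∀ x, J (x - D x) = x → ∀ n,
      ‖z (n + 1) - x‖ ^ 2 ≤ ‖z n - x‖ ^ 2 - ε * (1 - κ ^ 2) * ‖z n - s n‖ ^ 2 := by
    intro x hx n
    obtain ⟨hl1, hl2⟩ := hlam n
    -- The unrelaxed Tseng step; `z (n + 1)` is a convex combination of `z n` and `y`.
    set y := s n + D (z n) - D (s n) with hy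
    have hzy : z (n + 1) - x = (1 - lam n) • (z n - x) + lam n • (y - x) := by
      rw [hz n, hy]; module
    have m1 := hJ (z n - D (z n)) (x - D x)
    rw [← hs n, hx] at m1
    have m2 := hD (s n) x
    have m3 : 0 ≤ ⟪z n - y, s n - x⟫_ℝ := by
      have : ⟪z n - y, s n - x⟫_ℝ = ⟪z n - D (z n) - s n - (x - D x - x), s n - x⟫_ℝ
          + ⟪D (s n) - D x, s n - x⟫_ℝ := by
        rw [← inner_add_left]; congr 1; rw [hy]; abel
      rw [this]; exact add_nonneg m1 m2
    have m4 : ‖y - s n‖ ^ 2 ≤ κ ^ 2 * ‖z n - s n‖ ^ 2 := by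
      rw [← mul_pow]
      have : y - s n = D (z n) - D (s n) := by rw [hy]; abel
      rw [this]
      exact pow_le_pow_left₀ (norm_nonneg _) (hDlip _ _) 2
    have m5 : ‖y - x‖ ^ 2 = ‖z n - x‖ ^ 2 - ‖z n - s n‖ ^ 2 + ‖y - s n‖ ^ 2
        - 2 * ⟪z n - y, s n - x⟫_ℝ := by
      have a1 : y - x = (y - s n) + (s n - x) := by abel
      have a2 : z n - x = (z n - s n) + (s n - x) := by abel
      have a3 : z n - y = (z n - s n) - (y - s n) := by abel
      rw [a1, a2, a3, norm_add_sq_real, norm_add_sq_real,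
        inner_sub_left (z n - s n)]
      ring
    have m6 : ‖y - x‖ ^ 2 ≤ ‖z n - x‖ ^ 2 - (1 - κ ^ 2) * ‖z n - s n‖ ^ 2 := by linarith
    have m7 : ‖z (n + 1) - x‖ ^ 2 ≤ (1 - lam n) * ‖z n - x‖ ^ 2 + lam n * ‖y - x‖ ^ 2 := by
      rw [hzy, norm_add_sq_real, norm_smul, norm_smul, inner_smul_left, inner_smul_right,
        Real.norm_of_nonneg (by linarith), Real.norm_of_nonneg (by linarith)]
      have := norm_sub_sq_real (z n - x) (y - x)
      simp only [conj_trivial]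
      have h0 := mul_nonneg (mul_nonneg (sub_nonneg.2 hl2) (hε.le.trans hl1))
        (sq_nonneg ‖(z n - x) - (y - x)‖)
      rw [this] at h0
      linarith
    have m8 : ε * ((1 - κ ^ 2) * ‖z n - s n‖ ^ 2) ≤ lam n * ((1 - κ ^ 2) * ‖z n - s n‖ ^ 2) :=
      mul_le_mul_of_nonneg_right hl1 (mul_nonneg hκ2.le (sq_nonneg _))
    have m9 := mul_le_mul_of_nonneg_left m6 (hε.le.trans hl1)
    linarith
  have hfejer : ∀ x, J (x - D x) = x → Antitone fun n => ‖z n - x‖ := by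
    intro x hx
    refine antitone_nat_of_succ_le fun n => ?_
    refine le_of_sq_le_sq ?_ (norm_nonneg _)
    have := hstep x hx n
    have h0 : 0 ≤ ε * (1 - κ ^ 2) * ‖z n - s n‖ ^ 2 := by positivity
    linarith
  obtain ⟨x₀, hx₀⟩ := hsol
  have hzs : Tendsto (fun n => z n - s n) atTop (𝓝 0) := by
    have hlim := (tendsto_atTop_ciInf (hfejer x₀ hx₀)
      ⟨0, Set.forall_mem_range.2 fun _ => norm_nonneg _⟩).pow 2
    have hlim' := hlim.sub (hlim.comp (tendsto_add_atTop_nat 1))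
    rw [sub_self] at hlim'
    have hc : 0 < ε * (1 - κ ^ 2) := mul_pos hε hκ2
    have hsq : Tendsto (fun n => ‖z n - s n‖ ^ 2) atTop (𝓝 0) := by
      refine squeeze_zero (fun n => sq_nonneg _) (fun n => ?_)
        (by simpa using hlim'.const_mul (ε * (1 - κ ^ 2))⁻¹)
      rw [← div_eq_inv_mul, le_div_iff₀' hc]
      have := hstep x₀ hx₀ n
      linarith
    rw [tendsto_zero_iff_norm_tendsto_zero]
    simpa using! hsq.sqrt
  refine (exists_weak_limit_of_fejer (S := {x | J (x - D x) = x}) ⟨x₀, hx₀⟩ hfejer ?_)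
  intro U w hU hw
  have hJlip : ∀ x y, ‖J x - J y‖ ≤ ‖x - y‖ := by
    intro x y
    have h := hJ x y
    have e : (x - J x) - (y - J y) = (x - y) - (J x - J y) := by abel
    rw [e, inner_sub_left, real_inner_self_eq_norm_sq] at h
    have := real_inner_le_norm (x - y) (J x - J y)
    by_contra! hlt
    nlinarith [norm_nonneg (x - y)]
  -- Minty's trick. Write `J = (Id + A)⁻¹`; then `x` is the resolvent of `A + D` at `w`. Testing
  -- monotonicity of `A + D` at `s n` against `x` and passing to the limit gives `0 ≤ -‖w - x‖²`,
  -- hence `w = x`.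
  obtain ⟨x, hx⟩ : ∃ x, J (w - D x) = x := by
    have hc : ContractingWith ⟨κ, hκ₀⟩ fun x => J (w - D x) := by
      refine ⟨by exact_mod_cast hκ₁, LipschitzWith.of_dist_le_mul fun a b => ?_⟩
      rw [dist_eq_norm, dist_eq_norm]
      refine (hJlip _ _).trans ?_
      rw [sub_sub_sub_cancel_left, norm_sub_rev]
      exact hDlip a b
    exact ⟨hc.fixedPoint, hc.fixedPoint_isFixedPt⟩
  have hmono : ∀ n, 0 ≤ ⟪(z n - s n) - (D (z n) - D (s n)) - (w - x), s n - x⟫_ℝ := by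
    intro n
    have m1 := hJ (z n - D (z n)) (w - D x)
    rw [← hs n, hx] at m1
    have m2 := hD (s n) x
    have e : (z n - s n) - (D (z n) - D (s n)) - (w - x)
        = (z n - D (z n) - s n - (w - D x - x)) + (D (s n) - D x) := by abel
    rw [e, inner_add_left]
    exact add_nonneg m1 m2
  have hDzs : Tendsto (fun n => D (z n) - D (s n)) atTop (𝓝 0) := by
    rw [tendsto_zero_iff_norm_tendsto_zero] at hzs ⊢
    exact squeeze_zero (fun _ => norm_nonneg _) (fun n => hDlip _ _)
      (by simpa using hzs.const_mul κ)
  have hbd : ∃ R, ∀ n, ‖s n - x‖ ≤ R := by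
    obtain ⟨R, hR⟩ := hzs.norm.bddAbove_range
    refine ⟨R + ‖z 0 - x₀‖ + ‖x₀ - x‖, fun n => ?_⟩
    have h1 : ‖z n - s n‖ ≤ R := hR ⟨n, rfl⟩
    have h2 : ‖z n - x₀‖ ≤ ‖z 0 - x₀‖ := hfejer x₀ hx₀ (Nat.zero_le n)
    calc ‖s n - x‖ = ‖-(z n - s n) + (z n - x₀) + (x₀ - x)‖ := by congr 1; abel
      _ ≤ ‖-(z n - s n)‖ + ‖z n - x₀‖ + ‖x₀ - x‖ := norm_add₃_le
      _ ≤ _ := by rw [norm_neg]; gcongr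
  obtain ⟨R, hR⟩ := hbd
  have hsmall : Tendsto (fun n => ⟪(z n - s n) - (D (z n) - D (s n)), s n - x⟫_ℝ) atTop (𝓝 0) := by
    have h0 := (hzs.sub hDzs).norm.mul_const R
    simp only [sub_zero, norm_zero, zero_mul] at h0
    refine squeeze_zero_norm (fun n => ?_) h0
    exact (norm_inner_le_norm _ _).trans (mul_le_mul_of_nonneg_left (hR n) (norm_nonneg _))
  have hinner : Tendsto (fun n => ⟪w - x, s n - x⟫_ℝ) U (𝓝 ⟪w - x, w - x⟫_ℝ) := by
    have h0 : Tendsto (fun n => ⟪w - x, z n - s n⟫_ℝ) atTop (𝓝 0) := by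
      simpa using (tendsto_const_nhds (x := w - x)).inner hzs
    have h1 := ((hw (w - x)).sub (h0.mono_left hU)).sub_const ⟪w - x, x⟫_ℝ
    rw [sub_zero, ← inner_sub_right] at h1
    refine h1.congr fun n => ?_
    simp only [inner_sub_right]; ring
  have hlim := (hsmall.mono_left hU).sub hinner
  have hge : 0 ≤ 0 - ⟪w - x, w - x⟫_ℝ :=
    ge_of_tendsto' hlim fun n => by rw [← inner_sub_left]; exact hmono n
  have hwx : w = x := by
    rw [real_inner_self_eq_norm_sq] at hge
    have : ‖w - x‖ = 0 := by nlinarith [norm_nonneg (w - x)]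
    exact sub_eq_zero.1 (norm_eq_zero.1 this)
  rw [← hwx] at hx
  exact hx

/-! ### The projection encoded by the Moore-Penrose inverse. -/

/-- For a bounded operator with closed range, `L* (L*)†` is the orthogonal projection onto the
orthogonal complement of the kernel of `L`. -/
theorem adjMP_eq_sub_starProjection {H G : Type*} [NormedAddCommGroup H] [InnerProductSpace ℝ H]
    [CompleteSpace H] [NormedAddCommGroup G] [InnerProductSpace ℝ G] [CompleteSpace G]
    (L : H →L[ℝ] G) (hL : IsClosed (range L)) (x : H) :
    adjMP L x = x - L.ker.starProjection x := by
  set a : H := x - L.ker.starProjection x with ha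
  have hLa : L a = L x := by
    have : L (L.ker.starProjection x) = 0 := L.ker.starProjection_apply_mem x
    rw [ha, map_sub, this, sub_zero]
  have haperp : ∀ y, L y = 0 → ⟪a, y⟫_ℝ = 0 := fun y hy =>
    Submodule.starProjection_inner_eq_zero x y hy
  have hrange : IsClosed (L.range : Set G) := hL
  have : CompleteSpace L.range := hrange.completeSpace_coe
  obtain ⟨C, hC, hpre⟩ := L.rangeRestrict.exists_preimage_norm_le L.surjective_rangeRestrict
  -- The closed range theorem for `L*`: as `a ⊥ ker L`, the value `⟪a, y⟫` depends only on `L y`.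
  -- The open mapping bound makes it a bounded functional on the range, which Riesz represents by
  -- `g`.
  obtain ⟨g, hg⟩ : ∃ g : G, ∀ y, ⟪g, L y⟫_ℝ = ⟪a, y⟫_ℝ := by
    choose σ hσ hσn using hpre
    have hind : ∀ y, ⟪a, σ (L.rangeRestrict y)⟫_ℝ = ⟪a, y⟫_ℝ := by
      intro y
      rw [← sub_eq_zero, ← inner_sub_right]
      refine haperp _ ?_
      rw [map_sub, sub_eq_zero]
      exact congrArg Subtype.val (hσ (L.rangeRestrict y))
    let φ : L.range →ₗ[ℝ] ℝ :=
      { toFun := fun w => ⟪a, σ w⟫_ℝ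
        map_add' := fun w w' => by
          rw [← inner_add_right, ← hind (σ w + σ w'), map_add, hσ, hσ]
        map_smul' := fun c w => by
          rw [RingHom.id_apply, smul_eq_mul, ← inner_smul_right, ← hind (c • σ w), map_smul, hσ] }
    let Φ : L.range →L[ℝ] ℝ := φ.mkContinuous (‖a‖ * C) fun w => by
      refine (norm_inner_le_norm _ _).trans ?_
      rw [mul_assoc]
      exact mul_le_mul_of_nonneg_left (hσn w) (norm_nonneg _)
    refine ⟨((InnerProductSpace.toDual ℝ L.range).symm Φ : L.range), fun y => ?_⟩
    rw [← hind y]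
    exact InnerProductSpace.toDual_symm_apply (x := L.rangeRestrict y) (y := Φ)
  have hadj : L.adjoint g = a := by
    refine ext_inner_right ℝ fun y => ?_
    rw [ContinuousLinearMap.adjoint_inner_left, hg]
  -- Since `g` solves the normal equation, the constraint set is nonempty and `projOn` does not take
  -- its default value. Only membership in this set is used below, not minimality of the norm.
  have hmem : moorePenrose L.adjoint x ∈ {y : G | L.adjoint.adjoint (L.adjoint y)
      = L.adjoint.adjoint x} := by
    refine ((isProjOn_iff_eq_projOn ?_ ?_ ?_ 0 _).2 rfl).1
    · refine ⟨g, ?_⟩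
      rw [mem_ofPred_eq, ContinuousLinearMap.adjoint_adjoint, hadj, hLa]
    · exact isClosed_eq (by fun_prop) (by fun_prop)
    · intro y hy y' hy' s t _ _ hst
      simp only [mem_ofPred_eq, map_add, map_smul] at hy hy' ⊢
      rw [hy, hy', ← add_smul, hst, one_smul]
  rw [mem_ofPred_eq, ContinuousLinearMap.adjoint_adjoint] at hmem
  -- The difference lies in `ker L`, and both of its terms are orthogonal to `ker L`.
  have h0 : ⟪adjMP L x - a, adjMP L x - a⟫_ℝ = 0 := by
    have hk : L (adjMP L x - a) = 0 := by
      rw [map_sub, hLa, sub_eq_zero]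
      exact hmem
    rw [inner_sub_left, haperp _ hk, sub_zero]
    unfold adjMP at hk ⊢
    rw [ContinuousLinearMap.adjoint_inner_left, hk, inner_zero_right]
  exact sub_eq_zero.1 (inner_self_eq_zero.1 h0)

/-! ### Lagrange multipliers. -/

/-- If `x` minimizes `⟪g, ·⟫` over `K ∩ V`, with `K` convex and `V` a subspace that meets the
interior of `K`, then it minimizes some `⟪q, ·⟫` over `K`, where `q - g` is orthogonal to `V`. -/
theorem exists_lagrange_multiplier {H : Type*} [NormedAddCommGroup H] [InnerProductSpace ℝ H]
    [CompleteSpace H] {V : Submodule ℝ H} {K : Set H} (hK : Convex ℝ K) {x g : H} (hxV : x ∈ V)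
    (hxK : x ∈ K) (hint : (interior K ∩ V).Nonempty)
    (hg : ∀ y ∈ K, y ∈ V → 0 ≤ ⟪g, y - x⟫_ℝ) :
    ∃ q : H, (∀ v ∈ V, ⟪q, v⟫_ℝ = ⟪g, v⟫_ℝ) ∧ ∀ y ∈ K, 0 ≤ ⟪q, y - x⟫_ℝ := by
  obtain ⟨c, hcK, hcV⟩ := hint
  -- The cone of feasible directions of `K` at `x`. On `V` the functional `⟪g, ·⟫` is nonnegative on
  -- this cone, and the M. Riesz extension theorem keeps that positivity on all of `H`.
  let s : PointedCone ℝ H :=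
    { carrier := {h | ∃ r : ℝ, 0 < r ∧ x + r • h ∈ K}
      zero_mem' := ⟨1, one_pos, by simpa using hxK⟩
      add_mem' := by
        rintro h h' ⟨r, hr, hm⟩ ⟨r', hr', hm'⟩
        -- The step length at which the convex combination of `x + r • h` and `x + r' • h'` with
        -- weights proportional to `r'` and `r` is a multiple of `h + h'`.
        refine ⟨r * r' / (r + r'), by positivity, ?_⟩
        have := hK hm hm' (a := r' / (r + r')) (b := r / (r + r')) (by positivity)
          (by positivity) (by field_simp; ring)
        convert this using 1
        have e : (r' / (r + r') + r / (r + r')) • x = x := by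
          rw [← add_div, add_comm r', div_self (by positivity), one_smul]
        nth_rewrite 1 [← e]
        module
      smul_mem' := by
        rintro ⟨a, ha⟩ h ⟨r, hr, hm⟩
        change ∃ t : ℝ, 0 < t ∧ x + t • (a • h) ∈ K
        rcases (show (0 : ℝ) ≤ a from ha).eq_or_lt with h0 | h0
        · exact ⟨1, one_pos, by simpa [← h0] using hxK⟩
        · refine ⟨r / a, by positivity, ?_⟩
          rwa [smul_smul, div_mul_cancel₀ _ h0.ne'] }
  let φ : H →ₗ.[ℝ] ℝ := ⟨V, (innerₗ H g).comp V.subtype⟩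
  obtain ⟨ψ, hψV, hψs⟩ := riesz_extension s φ
    (by
      rintro ⟨v, hv⟩ ⟨r, hr, hm⟩
      have h1 := hg _ hm (V.add_mem hxV (V.smul_mem r hv))
      rw [add_sub_cancel_left, inner_smul_right] at h1
      exact (mul_nonneg_iff_of_pos_left hr).1 h1)
    (by
      -- Interiority of `c` provides `V + s = H`: moving from `c` a little in direction `y` stays in
      -- `K`.
      intro y
      have hev : ∀ᶠ r : ℝ in 𝓝[>] 0, c + r • y ∈ K := by
        refine nhdsWithin_le_nhds ?_
        have : ContinuousAt (fun r : ℝ => c + r • y) 0 := by fun_prop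
        refine this.eventually_mem ?_
        simpa using! mem_interior_iff_mem_nhds.1 hcK
      obtain ⟨r, hr, hr0⟩ := (hev.and self_mem_nhdsWithin).exists
      have hr0 : 0 < r := hr0
      refine ⟨⟨r⁻¹ • (c - x), V.smul_mem _ (V.sub_mem hcV hxV)⟩, r, hr0, ?_⟩
      rw [smul_add, smul_smul, mul_inv_cancel₀ hr0.ne', one_smul]
      convert hr using 1
      abel)
  have hψK : ∀ y ∈ K, 0 ≤ ψ (y - x) := fun y hy =>
    hψs _ ⟨1, one_pos, by simpa using hy⟩
  obtain ⟨ρ, hρ, hball⟩ := Metric.isOpen_iff.1 isOpen_interior c hcK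
  -- Interiority again: the extension is bounded on a ball, hence continuous.
  have hbound : ∀ h ∈ Metric.ball (0 : H) ρ, ‖ψ h‖ ≤ ψ (c - x) := by
    have aux : ∀ h ∈ Metric.ball (0 : H) ρ, 0 ≤ ψ (c - x) + ψ h := by
      intro h hh
      have := hψK (c + h) (interior_subset (hball (by simpa using hh)))
      rwa [add_sub_right_comm, map_add] at this
    intro h hh
    have h1 := aux h hh
    have h2 := aux (-h) (by simpa using hh)
    rw [map_neg] at h2
    rw [Real.norm_eq_abs, abs_le]
    constructor <;> linarith
  obtain ⟨C, hC⟩ := LinearMap.bound_of_ball_bound hρ _ ψ hbound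
  have hq : ∀ h, ⟪(InnerProductSpace.toDual ℝ H).symm (ψ.mkContinuous C hC), h⟫_ℝ = ψ h :=
    fun h => InnerProductSpace.toDual_symm_apply
  refine ⟨(InnerProductSpace.toDual ℝ H).symm (ψ.mkContinuous C hC), fun v hv => ?_, fun y hy => ?_⟩
  · rw [hq]; exact hψV ⟨v, hv⟩
  · rw [hq]; exact hψK y hy

/-! ### Gradients and the saddle operator. -/

section Gradient

variable {H H₁ H₂ : Type*} [NormedAddCommGroup H] [InnerProductSpace ℝ H] [CompleteSpace H]
  [NormedAddCommGroup H₁] [InnerProductSpace ℝ H₁] [CompleteSpace H₁]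
  [NormedAddCommGroup H₂] [InnerProductSpace ℝ H₂] [CompleteSpace H₂]

theorem ConvexOn.add_inner_le_of_hasGradientAt {φ : H → ℝ} (hφ : ConvexOn ℝ univ φ) {x g : H}
    (hg : HasGradientAt φ g x) (y : H) : φ x + ⟪g, y - x⟫_ℝ ≤ φ y := by
  have hline : ConvexOn ℝ univ (φ ∘ AffineMap.lineMap (k := ℝ) x y) := by
    simpa using hφ.comp_affineMap (AffineMap.lineMap (k := ℝ) x y)
  have hd : HasDerivAt (φ ∘ AffineMap.lineMap (k := ℝ) x y) ⟪g, y - x⟫_ℝ 0 := by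
    have h0 : HasFDerivAt φ (InnerProductSpace.toDual ℝ H g) (AffineMap.lineMap (k := ℝ) x y 0) := by
      simpa using hg.hasFDerivAt
    exact h0.comp_hasDerivAt (0 : ℝ) AffineMap.hasDerivAt_lineMap
  have h := hline.le_slope_of_hasDerivAt (mem_univ 0) (mem_univ 1) one_pos hd
  simp only [slope, Function.comp, AffineMap.lineMap_apply_zero, AffineMap.lineMap_apply_one,
    sub_zero, inv_one, one_smul, vsub_eq_sub] at h
  linarith

theorem ConcaveOn.le_add_inner_of_hasGradientAt {φ : H → ℝ} (hφ : ConcaveOn ℝ univ φ) {x g : H}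
    (hg : HasGradientAt φ g x) (y : H) : φ y ≤ φ x + ⟪g, y - x⟫_ℝ := by
  have hg' : HasGradientAt (-φ) (-g) x := by
    rw [hasGradientAt_iff_hasFDerivAt, map_neg]
    exact hg.hasFDerivAt.neg
  have h := hφ.neg.add_inner_le_of_hasGradientAt hg' y
  rw [inner_neg_left] at h
  simp only [Pi.neg_apply] at h
  linarith

theorem inner_gradient_nonneg_of_isMinOn {φ : H → ℝ} {S : Set H} (hS : Convex ℝ S) {x g : H}
    (hg : HasGradientAt φ g x) (hx : x ∈ S) (hmin : IsMinOn φ S x) {y : H} (hy : y ∈ S) :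
    0 ≤ ⟪g, y - x⟫_ℝ := by
  have := hmin.localize.hasFDerivWithinAt_nonneg hg.hasFDerivAt.hasFDerivWithinAt
    (sub_mem_posTangentConeAt_of_segment_subset (hS.segment_subset hx hy))
  simpa using this

theorem inner_gradient_nonpos_of_isMaxOn {φ : H → ℝ} {S : Set H} (hS : Convex ℝ S) {x g : H}
    (hg : HasGradientAt φ g x) (hx : x ∈ S) (hmax : IsMaxOn φ S x) {y : H} (hy : y ∈ S) :
    ⟪g, y - x⟫_ℝ ≤ 0 := by
  have := hmax.localize.hasFDerivWithinAt_nonpos hg.hasFDerivAt.hasFDerivWithinAt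
    (sub_mem_posTangentConeAt_of_segment_subset (hS.segment_subset hx hy))
  simpa using this

variable {f : WithLp 2 (H₁ × H₂) → ℝ}

theorem hasGradientAt_fst (hf : Differentiable ℝ f) (x₁ : H₁) (x₂ : H₂) :
    HasGradientAt (fun y₁ => f (WithLp.toLp 2 (y₁, x₂))) (∇ f (WithLp.toLp 2 (x₁, x₂))).fst x₁ := by
  have h := (hf (WithLp.toLp 2 (x₁, x₂))).hasGradientAt.hasFDerivAt
  have h' := (WithLp.prodContinuousLinearEquiv 2 ℝ H₁ H₂).symm.hasFDerivAt (x := (x₁, x₂))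
  generalize ∇ f (WithLp.toLp 2 (x₁, x₂)) = g at h ⊢
  rw [hasGradientAt_iff_hasFDerivAt]
  refine (h.comp x₁ (h'.comp x₁ (hasFDerivAt_prodMk_left x₁ x₂))).congr_fderiv ?_
  ext v
  simp

theorem hasGradientAt_snd (hf : Differentiable ℝ f) (x₁ : H₁) (x₂ : H₂) :
    HasGradientAt (fun y₂ => f (WithLp.toLp 2 (x₁, y₂))) (∇ f (WithLp.toLp 2 (x₁, x₂))).snd x₂ := by
  have h := (hf (WithLp.toLp 2 (x₁, x₂))).hasGradientAt.hasFDerivAt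
  have h' := (WithLp.prodContinuousLinearEquiv 2 ℝ H₁ H₂).symm.hasFDerivAt (x := (x₁, x₂))
  generalize ∇ f (WithLp.toLp 2 (x₁, x₂)) = g at h ⊢
  rw [hasGradientAt_iff_hasFDerivAt]
  refine (h.comp x₂ (h'.comp x₂ (hasFDerivAt_prodMk_right x₁ x₂))).congr_fderiv ?_
  ext v
  simp

theorem gradFst_eq (hf : Differentiable ℝ f) (x₁ : H₁) (x₂ : H₂) :
    gradFst f x₁ x₂ = (∇ f (WithLp.toLp 2 (x₁, x₂))).fst :=
  (hasGradientAt_fst hf x₁ x₂).gradient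

theorem gradSnd_eq (hf : Differentiable ℝ f) (x₁ : H₁) (x₂ : H₂) :
    gradSnd f x₁ x₂ = (∇ f (WithLp.toLp 2 (x₁, x₂))).snd :=
  (hasGradientAt_snd hf x₁ x₂).gradient

theorem hasGradientAt_gradFst (hf : Differentiable ℝ f) (x₁ : H₁) (x₂ : H₂) :
    HasGradientAt (fun y₁ => f (WithLp.toLp 2 (y₁, x₂))) (gradFst f x₁ x₂) x₁ :=
  gradFst_eq hf x₁ x₂ ▸ hasGradientAt_fst hf x₁ x₂

theorem hasGradientAt_gradSnd (hf : Differentiable ℝ f) (x₁ : H₁) (x₂ : H₂) :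
    HasGradientAt (fun y₂ => f (WithLp.toLp 2 (x₁, y₂))) (gradSnd f x₁ x₂) x₂ :=
  gradSnd_eq hf x₁ x₂ ▸ hasGradientAt_snd hf x₁ x₂

/-- The saddle operator of a convex-concave function is monotone. -/
theorem saddle_operator_monotone (hf : Differentiable ℝ f)
    (hconcave : ∀ y₁ : H₁, ConcaveOn ℝ univ (fun y₂ : H₂ => f (WithLp.toLp 2 (y₁, y₂))))
    (hconvex : ∀ y₂ : H₂, ConvexOn ℝ univ (fun y₁ : H₁ => f (WithLp.toLp 2 (y₁, y₂))))
    (x₁ y₁ : H₁) (x₂ y₂ : H₂) :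
    0 ≤ ⟪gradFst f x₁ x₂ - gradFst f y₁ y₂, x₁ - y₁⟫_ℝ
      - ⟪gradSnd f x₁ x₂ - gradSnd f y₁ y₂, x₂ - y₂⟫_ℝ := by
  -- Summing the four gradient inequalities around the rectangle with corners `(x₁, x₂)`, `(y₁,
  -- x₂)`, `(y₁, y₂)`, `(x₁, y₂)` cancels all values of `f`.
  have h1 := (hconvex x₂).add_inner_le_of_hasGradientAt (hasGradientAt_gradFst hf x₁ x₂) y₁
  have h2 := (hconvex y₂).add_inner_le_of_hasGradientAt (hasGradientAt_gradFst hf y₁ y₂) x₁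
  have h3 := (hconcave x₁).le_add_inner_of_hasGradientAt (hasGradientAt_gradSnd hf x₁ x₂) y₂
  have h4 := (hconcave y₁).le_add_inner_of_hasGradientAt (hasGradientAt_gradSnd hf y₁ y₂) x₂
  rw [← neg_sub x₁ y₁, inner_neg_right] at h1
  rw [← neg_sub x₂ y₂, inner_neg_right] at h3
  rw [inner_sub_left, inner_sub_left]
  linarith

theorem saddle_operator_lipschitz (hf : Differentiable ℝ f) {χ : ℝ}
    (hlip : ∀ x y : WithLp 2 (H₁ × H₂), ‖∇ f x - ∇ f y‖ ≤ χ * ‖x - y‖)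
    (x₁ y₁ : H₁) (x₂ y₂ : H₂) :
    ‖gradFst f x₁ x₂ - gradFst f y₁ y₂‖ ^ 2 + ‖gradSnd f x₁ x₂ - gradSnd f y₁ y₂‖ ^ 2
      ≤ χ ^ 2 * (‖x₁ - y₁‖ ^ 2 + ‖x₂ - y₂‖ ^ 2) := by
  have h := pow_le_pow_left₀ (norm_nonneg _)
    (hlip (WithLp.toLp 2 (x₁, x₂)) (WithLp.toLp 2 (y₁, y₂))) 2
  rw [mul_pow, WithLp.prod_norm_sq_eq_of_L2, WithLp.prod_norm_sq_eq_of_L2] at h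
  simpa [gradFst_eq hf, gradSnd_eq hf] using h

end Gradient

/-! ### Partial inverse of the normal cone. -/

section Resolvent

variable {H : Type*} [NormedAddCommGroup H] [InnerProductSpace ℝ H]

variable (C : Set H) (e : H) (V : Submodule ℝ H) [V.HasOrthogonalProjection]

/-- The resolvent of the partial inverse, with respect to the subspace `V`, of the normal cone
operator of `C - e`. -/
noncomputable def partialInverseResolvent (r : H) : H :=
  V.starProjection (projOn C (r + e) - e)
    + ((r - (projOn C (r + e) - e)) - V.starProjection (r - (projOn C (r + e) - e)))

variable {C e V}

theorem starProjection_starProjection_apply (x : H) :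
    V.starProjection (V.starProjection x) = V.starProjection x :=
  V.starProjection_eq_self_iff.2 (V.starProjection_apply_mem x)

theorem inner_starProjection_left_eq (x y : H) :
    ⟪V.starProjection x, y⟫_ℝ = ⟪x, V.starProjection y⟫_ℝ :=
  V.starProjection_isSymmetric x y

theorem starProjection_partialInverseResolvent (r : H) :
    V.starProjection (partialInverseResolvent C e V r)
      = V.starProjection (projOn C (r + e) - e) := by
  simp only [partialInverseResolvent, map_add, map_sub, starProjection_starProjection_apply]
  abel

variable [CompleteSpace H]

theorem eq_projOn_iff (hne : C.Nonempty) (hcl : IsClosed C) (hcv : Convex ℝ C)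
    (x p : H) : p = projOn C x ↔ p ∈ C ∧ ∀ w ∈ C, ⟪x - p, w - p⟫_ℝ ≤ 0 := by
  rw [← isProjOn_iff_eq_projOn hne hcl hcv]
  refine and_congr_right fun hp => ?_
  rw [← norm_eq_iInf_iff_real_inner_le_zero hcv hp]
  have : Nonempty C := hne.to_subtype
  have hbdd : BddBelow (range fun w : C => ‖x - w‖) :=
    ⟨0, Set.forall_mem_range.2 fun _ => norm_nonneg _⟩
  refine ⟨fun h => le_antisymm (le_ciInf fun w => h w w.2) (ciInf_le hbdd ⟨p, hp⟩),
    fun h y hy => h.trans_le (ciInf_le hbdd ⟨y, hy⟩)⟩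

/-- Let `a` and `b` be the increments of the projection and of its residual; `0 ≤ ⟪b, a⟫`. Passing
to the partial inverse exchanges their components in the complement of `V`, which leaves the inner
product unchanged. -/
theorem partialInverseResolvent_firmlyNonexpansive (hne : C.Nonempty) (hcl : IsClosed C)
    (hcv : Convex ℝ C) (x y : H) :
    0 ≤ ⟪(x - partialInverseResolvent C e V x) - (y - partialInverseResolvent C e V y),
      partialInverseResolvent C e V x - partialInverseResolvent C e V y⟫_ℝ := by
  have hx := (eq_projOn_iff hne hcl hcv (x + e) _).1 rfl
  have hy := (eq_projOn_iff hne hcl hcv (y + e) _).1 rfl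
  have h1 := hx.2 _ hy.1
  have h2 := hy.2 _ hx.1
  unfold partialInverseResolvent
  set p := projOn C (x + e)
  set q := projOn C (y + e)
  set a := p - q with ha
  set b := (x - y) - (p - q) with hb
  have hab : 0 ≤ ⟪b, a⟫_ℝ := by
    have e1 : ⟪b, a⟫_ℝ = -⟪x + e - p, q - p⟫_ℝ - ⟪y + e - q, p - q⟫_ℝ := by
      rw [← inner_neg_right, neg_sub, ← inner_sub_left]
      congr 1
      rw [hb]; abel
    rw [e1]; linarith
  have e2 : x - (V.starProjection (p - e) + ((x - (p - e)) - V.starProjection (x - (p - e))))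
      - (y - (V.starProjection (q - e) + ((y - (q - e)) - V.starProjection (y - (q - e)))))
      = V.starProjection b + (a - V.starProjection a) := by
    simp only [ha, hb, map_sub]; abel
  have e3 : V.starProjection (p - e) + ((x - (p - e)) - V.starProjection (x - (p - e)))
      - (V.starProjection (q - e) + ((y - (q - e)) - V.starProjection (y - (q - e))))
      = V.starProjection a + (b - V.starProjection b) := by
    simp only [ha, hb, map_sub]; abel
  rw [e2, e3]
  have e4 : ⟪V.starProjection b + (a - V.starProjection a),
      V.starProjection a + (b - V.starProjection b)⟫_ℝ = ⟪b, a⟫_ℝ := by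
    simp only [inner_add_left, inner_add_right, inner_sub_left, inner_sub_right,
      inner_starProjection_left_eq, starProjection_starProjection_apply]
    rw [real_inner_comm a b, ← inner_starProjection_left_eq a b, real_inner_comm]
    ring
  rwa [e4]

/-- Comparing components in `V` and in its complement forces the projected point, shifted by `-e`,
to be `P_V w`. In the variational inequality of `P_C` the part `w - P_V w` vanishes on `V`, so only
`d` survives. -/
theorem variational_of_partialInverseResolvent_eq (hne : C.Nonempty) (hcl : IsClosed C)
    (hcv : Convex ℝ C) {w d : H} (hd : d ∈ V)
    (hw : partialInverseResolvent C e V (w - d) = w) :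
    V.starProjection w + e ∈ C ∧
      ∀ y ∈ C, y - e ∈ V → 0 ≤ ⟪d, y - (V.starProjection w + e)⟫_ℝ := by
  have hp := (eq_projOn_iff hne hcl hcv (w - d + e) _).1 rfl
  have h1 := starProjection_partialInverseResolvent (C := C) (e := e) (V := V) (w - d)
  rw [hw] at h1
  have hd' := V.starProjection_eq_self_iff.2 hd
  have h2 : projOn C (w - d + e) = V.starProjection w + e := by
    have h3 : w = V.starProjection w + ((w - d - (projOn C (w - d + e) - e))
        - (V.starProjection w - d - V.starProjection w)) := by
      conv_lhs => rw [← hw, partialInverseResolvent, ← h1, map_sub _ (w - d), ← h1, map_sub, hd']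
    have h4 : V.starProjection w + ((w - d - (projOn C (w - d + e) - e))
        - (V.starProjection w - d - V.starProjection w))
        = w + (V.starProjection w + e - projOn C (w - d + e)) := by abel
    rw [h4, left_eq_add, sub_eq_zero] at h3
    exact h3.symm
  rw [h2] at hp
  refine ⟨hp.1, fun y hy hyV => ?_⟩
  have h5 := hp.2 y hy
  have h6 : y - (V.starProjection w + e) ∈ V := by
    rw [← sub_sub, sub_right_comm]
    exact V.sub_mem hyV (V.starProjection_apply_mem w)
  have h7 := V.starProjection_inner_eq_zero w _ h6
  have h8 : w - d + e - (V.starProjection w + e) = (w - V.starProjection w) - d := by abel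
  rw [h8, inner_sub_left, h7] at h5
  linarith

/-- With a multiplier `q`, take `w = (x - e) - γ (q - P_V q)`. As `P_V q = P_V g`, the point to be
projected is `x - γ q`, and `-q` is normal to `C` at `x`, so its projection is `x`. -/
theorem exists_partialInverseResolvent_eq (hcl : IsClosed C)
    (hcv : Convex ℝ C) (hint : (interior ((fun x => x - e) '' C) ∩ V).Nonempty) {x g : H}
    (hxC : x ∈ C) (hxV : x - e ∈ V) (hg : ∀ y ∈ C, y - e ∈ V → 0 ≤ ⟪g, y - x⟫_ℝ) {γ : ℝ}
    (hγ : 0 ≤ γ) :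
    ∃ w : H, V.starProjection w = x - e ∧
      partialInverseResolvent C e V (w - γ • V.starProjection g) = w := by
  obtain ⟨q, hqV, hqC⟩ := exists_lagrange_multiplier (K := (fun x => x - e) '' C) (x := x - e)
    (g := g) (by simpa [sub_eq_add_neg, add_comm] using! hcv.translate (-e)) hxV ⟨x, hxC, rfl⟩ hint
    (by
      rintro _ ⟨y, hy, rfl⟩ hyV
      simpa using hg y hy hyV)
  have hPq : V.starProjection q = V.starProjection g := by
    rw [← sub_eq_zero, ← map_sub, Submodule.starProjection_apply_eq_zero_iff,
      Submodule.mem_orthogonal']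
    intro v hv
    rw [inner_sub_left, hqV v hv, sub_self]
  have hPx := V.starProjection_eq_self_iff.2 hxV
  have hproj : projOn C ((x - e) - γ • (q - V.starProjection q) - γ • V.starProjection g + e)
      = x := by
    refine ((eq_projOn_iff ⟨x, hxC⟩ hcl hcv _ _).2 ⟨hxC, fun y hy => ?_⟩).symm
    have h := hqC _ ⟨y, hy, rfl⟩
    have e1 : (x - e) - γ • (q - V.starProjection q) - γ • V.starProjection g + e - x
        = -(γ • q) := by rw [hPq]; module
    rw [e1, inner_neg_left, inner_smul_left]
    simp only [sub_sub_sub_cancel_right] at h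
    simpa using mul_nonneg hγ h
  refine ⟨(x - e) - γ • (q - V.starProjection q), ?_, ?_⟩
  · simp [hPx, starProjection_starProjection_apply]
  · unfold partialInverseResolvent
    rw [hproj]
    simp only [map_sub, map_smul, hPx, starProjection_starProjection_apply, hPq]
    module

end Resolvent

/-! ### The game and the convergence theorem. -/

theorem mem_strategySet_iff {H G : Type*} [NormedAddCommGroup H] [InnerProductSpace ℝ H]
    [NormedAddCommGroup G] [InnerProductSpace ℝ G] {C : Set H} {L : H →L[ℝ] G} {e x : H} :
    x ∈ strategySet C L (L e) ↔ x ∈ C ∧ x - e ∈ L.ker := by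
  refine and_congr_right fun _ => ?_
  rw [LinearMap.mem_ker, map_sub, sub_eq_zero]
  rfl

theorem convex_strategySet {H G : Type*} [NormedAddCommGroup H] [InnerProductSpace ℝ H]
    [NormedAddCommGroup G] [InnerProductSpace ℝ G] {C : Set H} (hC : Convex ℝ C) (L : H →L[ℝ] G)
    (b : G) : Convex ℝ (strategySet C L b) :=
  hC.inter ((convex_singleton b).linear_preimage L.toLinearMap)

theorem weaklyConverges_clm_add {H : Type*} [NormedAddCommGroup H] [InnerProductSpace ℝ H]
    [CompleteSpace H] {z : ℕ → H} {w : H} (hz : WeaklyConverges z w) (T : H →L[ℝ] H) (e : H) :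
    WeaklyConverges (fun n => T (z n) + e) (T w + e) := by
  rw [weaklyConverges_iff_tendsto_inner] at hz ⊢
  intro y
  simp only [inner_add_right, ← ContinuousLinearMap.adjoint_inner_left]
  exact (hz _).add_const _

theorem theoremt
    {H₁ H₂ G₁ G₂ : Type*}
    [NormedAddCommGroup H₁] [InnerProductSpace ℝ H₁] [CompleteSpace H₁]
    [NormedAddCommGroup H₂] [InnerProductSpace ℝ H₂] [CompleteSpace H₂]
    [NormedAddCommGroup G₁] [InnerProductSpace ℝ G₁] [CompleteSpace G₁]
    [NormedAddCommGroup G₂] [InnerProductSpace ℝ G₂] [CompleteSpace G₂]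
    -- the game
    (C₁ : Set H₁) (C₂ : Set H₂)
    (hC₁ : IsClosed C₁) (hC₂ : IsClosed C₂) (hC₁' : Convex ℝ C₁) (hC₂' : Convex ℝ C₂)
    (L₁ : H₁ →L[ℝ] G₁) (L₂ : H₂ →L[ℝ] G₂)
    (hL₁ : IsClosed (Set.range L₁)) (hL₂ : IsClosed (Set.range L₂))
    (e₁ : H₁) (e₂ : H₂) (b₁ : G₁) (b₂ : G₂) (hb₁ : b₁ = L₁ e₁) (hb₂ : b₂ = L₂ e₂)
    (χ : ℝ) (hχ : 0 < χ)
    (f : WithLp 2 (H₁ × H₂) → ℝ) (hf : Differentiable ℝ f)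
    (hf_lip : ∀ x y : WithLp 2 (H₁ × H₂), ‖∇ f x - ∇ f y‖ ≤ χ * ‖x - y‖)
    (hf_concave : ∀ y₁ : H₁, ConcaveOn ℝ Set.univ (fun y₂ : H₂ => f (WithLp.toLp 2 (y₁, y₂))))
    (hf_convex : ∀ y₂ : H₂, ConvexOn ℝ Set.univ (fun y₁ : H₁ => f (WithLp.toLp 2 (y₁, y₂))))
    (hq₁ : (interior ((fun x => x - e₁) '' C₁) ∩ {x | L₁ x = 0}).Nonempty)
    (hq₂ : (interior ((fun x => x - e₂) '' C₂) ∩ {x | L₂ x = 0}).Nonempty)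
    (hsol : ∃ x₁ x₂, IsNashEquilibrium f (strategySet C₁ L₁ b₁) (strategySet C₂ L₂ b₂) x₁ x₂)
    -- the parameters
    (ε : ℝ) (hε : ε ∈ Set.Ioo (0 : ℝ) 1) (γ : ℝ) (hγ : γ ∈ Set.Ioo (0 : ℝ) (1 / χ))
    (lam : ℕ → ℝ) (hlam : ∀ n, lam n ∈ Set.Icc ε 1)
    -- the iteration, from an arbitrary starting point `(z₁ 0, z₂ 0)`
    (z₁ u₁ g₁ r₁ p₁ v₁ s₁ h₁ t₁ : ℕ → H₁) (z₂ u₂ g₂ r₂ p₂ v₂ s₂ h₂ t₂ : ℕ → H₂)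
    (hu₁ : ∀ n, u₁ n = z₁ n - adjMP L₁ (z₁ n))
    (hu₂ : ∀ n, u₂ n = z₂ n - adjMP L₂ (z₂ n))
    (hg₁ : ∀ n, g₁ n = gradFst f (e₁ + u₁ n) (e₂ + u₂ n)
      - adjMP L₁ (gradFst f (e₁ + u₁ n) (e₂ + u₂ n)))
    (hg₂ : ∀ n, g₂ n = -gradSnd f (e₁ + u₁ n) (e₂ + u₂ n)
      + adjMP L₂ (gradSnd f (e₁ + u₁ n) (e₂ + u₂ n)))
    (hr₁ : ∀ n, r₁ n = z₁ n - γ • g₁ n)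
    (hr₂ : ∀ n, r₂ n = z₂ n - γ • g₂ n)
    (hp₁ : ∀ n, p₁ n = projOn C₁ (r₁ n + e₁) - e₁)
    (hp₂ : ∀ n, p₂ n = projOn C₂ (r₂ n + e₂) - e₂)
    (hv₁ : ∀ n, v₁ n = p₁ n - adjMP L₁ (p₁ n))
    (hv₂ : ∀ n, v₂ n = p₂ n - adjMP L₂ (p₂ n))
    (hs₁ : ∀ n, s₁ n = (2 : ℝ) • v₁ n - p₁ n + adjMP L₁ (r₁ n))
    (hs₂ : ∀ n, s₂ n = (2 : ℝ) • v₂ n - p₂ n + adjMP L₂ (r₂ n))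
    (hh₁ : ∀ n, h₁ n = gradFst f (e₁ + v₁ n) (e₂ + v₂ n)
      - adjMP L₁ (gradFst f (e₁ + v₁ n) (e₂ + v₂ n)))
    (hh₂ : ∀ n, h₂ n = -gradSnd f (e₁ + v₁ n) (e₂ + v₂ n)
      + adjMP L₂ (gradSnd f (e₁ + v₁ n) (e₂ + v₂ n)))
    (ht₁ : ∀ n, t₁ n = s₁ n - γ • h₁ n)
    (ht₂ : ∀ n, t₂ n = s₂ n - γ • h₂ n)
    (hz₁ : ∀ n, z₁ (n + 1) = z₁ n + lam n • (t₁ n - r₁ n))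
    (hz₂ : ∀ n, z₂ (n + 1) = z₂ n + lam n • (t₂ n - r₂ n)) :
    ∃ (x₁ : H₁) (x₂ : H₂) (w₁ : H₁) (w₂ : H₂),
      IsNashEquilibrium f (strategySet C₁ L₁ b₁) (strategySet C₂ L₂ b₂) x₁ x₂ ∧
      WeaklyConverges (fun n => u₁ n + e₁) x₁ ∧
      WeaklyConverges (fun n => u₂ n + e₂) x₂ ∧
      WeaklyConverges (fun n => z₁ n + e₁) (w₁ + e₁) ∧
      WeaklyConverges (fun n => z₂ n + e₂) (w₂ + e₂) ∧
      x₁ = (w₁ - adjMP L₁ w₁) + e₁ ∧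
      x₂ = (w₂ - adjMP L₂ w₂) + e₂ := by
  subst hb₁ hb₂
  obtain ⟨hε₀, -⟩ := hε
  obtain ⟨hγ₀, hγ₁⟩ := hγ
  have hκ : γ * χ < 1 := (lt_div_iff₀ hχ).1 hγ₁
  obtain ⟨x₁, x₂, hx₁, hx₂, hmin, hmax⟩ := hsol
  obtain ⟨hx₁C, hx₁V⟩ := mem_strategySet_iff.1 hx₁
  obtain ⟨hx₂C, hx₂V⟩ := mem_strategySet_iff.1 hx₂
  simp only [adjMP_eq_sub_starProjection L₁ hL₁, adjMP_eq_sub_starProjection L₂ hL₂,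
    sub_sub_cancel] at *
  set P₁ := L₁.ker.starProjection with hP₁
  set P₂ := L₂.ker.starProjection with hP₂
  set J : WithLp 2 (H₁ × H₂) → WithLp 2 (H₁ × H₂) := fun z =>
    WithLp.toLp 2 (partialInverseResolvent C₁ e₁ L₁.ker z.fst,
      partialInverseResolvent C₂ e₂ L₂.ker z.snd) with hJ
  set D : WithLp 2 (H₁ × H₂) → WithLp 2 (H₁ × H₂) := fun z =>
    WithLp.toLp 2 (γ • P₁ (gradFst f (e₁ + P₁ z.fst) (e₂ + P₂ z.snd)),
      -(γ • P₂ (gradSnd f (e₁ + P₁ z.fst) (e₂ + P₂ z.snd)))) with hD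
  have hJmono : ∀ x y, 0 ≤ ⟪(x - J x) - (y - J y), J x - J y⟫_ℝ := fun x y =>
    add_nonneg (partialInverseResolvent_firmlyNonexpansive ⟨x₁, hx₁C⟩ hC₁ hC₁' x.fst y.fst)
      (partialInverseResolvent_firmlyNonexpansive ⟨x₂, hx₂C⟩ hC₂ hC₂' x.snd y.snd)
  have hDmono : ∀ x y, 0 ≤ ⟪D x - D y, x - y⟫_ℝ := by
    intro x y
    have h := mul_nonneg hγ₀.le (saddle_operator_monotone hf hf_concave hf_convex (e₁ + P₁ x.fst)
      (e₁ + P₁ y.fst) (e₂ + P₂ x.snd) (e₂ + P₂ y.snd))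
    rw [add_sub_add_left_eq_sub, add_sub_add_left_eq_sub, ← map_sub, ← map_sub,
      ← inner_starProjection_left_eq, ← inner_starProjection_left_eq] at h
    refine h.trans_eq ?_
    simp only [hD, WithLp.prod_inner_apply, WithLp.ofLp_fst, WithLp.ofLp_snd,
      map_sub, inner_sub_left, inner_sub_right,
      inner_neg_left, real_inner_smul_left, hP₁, hP₂]
    ring
  have hDlip : ∀ x y, ‖D x - D y‖ ≤ γ * χ * ‖x - y‖ := by
    intro x y
    refine le_of_sq_le_sq ?_ (by positivity)
    have h := saddle_operator_lipschitz hf hf_lip (e₁ + P₁ x.fst) (e₁ + P₁ y.fst)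
      (e₂ + P₂ x.snd) (e₂ + P₂ y.snd)
    rw [add_sub_add_left_eq_sub, add_sub_add_left_eq_sub, ← map_sub, ← map_sub] at h
    have a₁ := pow_le_pow_left₀ (norm_nonneg _)
      (L₁.ker.norm_starProjection_apply_le (x.fst - y.fst)) 2
    have a₂ := pow_le_pow_left₀ (norm_nonneg _)
      (L₂.ker.norm_starProjection_apply_le (x.snd - y.snd)) 2
    have c₁ := pow_le_pow_left₀ (norm_nonneg _) (L₁.ker.norm_starProjection_apply_le
      (gradFst f (e₁ + P₁ x.fst) (e₂ + P₂ x.snd) - gradFst f (e₁ + P₁ y.fst) (e₂ + P₂ y.snd))) 2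
    have c₂ := pow_le_pow_left₀ (norm_nonneg _) (L₂.ker.norm_starProjection_apply_le
      (gradSnd f (e₁ + P₁ x.fst) (e₂ + P₂ x.snd) - gradSnd f (e₁ + P₁ y.fst) (e₂ + P₂ y.snd))) 2
    have hn : ‖D x - D y‖ ^ 2
        = γ ^ 2 * (‖P₁ (gradFst f (e₁ + P₁ x.fst) (e₂ + P₂ x.snd)
            - gradFst f (e₁ + P₁ y.fst) (e₂ + P₂ y.snd))‖ ^ 2
          + ‖P₂ (gradSnd f (e₁ + P₁ x.fst) (e₂ + P₂ x.snd)
            - gradSnd f (e₁ + P₁ y.fst) (e₂ + P₂ y.snd))‖ ^ 2) := by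
      rw [WithLp.prod_norm_sq_eq_of_L2, WithLp.sub_fst, WithLp.sub_snd]
      simp only [hD, WithLp.toLp_fst, WithLp.toLp_snd]
      rw [neg_sub_neg, ← smul_sub, ← smul_sub, ← map_sub, ← map_sub, norm_smul, norm_smul,
        Real.norm_of_nonneg hγ₀.le, ← neg_sub (gradSnd f (e₁ + P₁ x.fst) (e₂ + P₂ x.snd)), map_neg,
        norm_neg]
      ring
    rw [hn, mul_pow, mul_pow, mul_assoc, WithLp.prod_norm_sq_eq_of_L2 (x - y), WithLp.sub_fst,
      WithLp.sub_snd]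
    refine mul_le_mul_of_nonneg_left ?_ (sq_nonneg γ)
    exact (add_le_add c₁ c₂).trans
      (h.trans (mul_le_mul_of_nonneg_left (add_le_add a₁ a₂) (sq_nonneg χ)))
  -- The first-order conditions of the given equilibrium feed the multiplier lemma; the interior
  -- conditions enter only here.
  have hfix : ∃ x, J (x - D x) = x := by
    obtain ⟨w₁, hw₁, hw₁'⟩ := exists_partialInverseResolvent_eq (e := e₁) (V := L₁.ker) hC₁ hC₁' hq₁
      hx₁C hx₁V (g := gradFst f x₁ x₂) (fun y hy hyV => inner_gradient_nonneg_of_isMinOn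
        (convex_strategySet hC₁' L₁ _) (hasGradientAt_gradFst hf x₁ x₂) hx₁ hmin
        (mem_strategySet_iff.2 ⟨hy, hyV⟩)) hγ₀.le
    obtain ⟨w₂, hw₂, hw₂'⟩ := exists_partialInverseResolvent_eq (e := e₂) (V := L₂.ker) hC₂ hC₂' hq₂
      hx₂C hx₂V (g := -gradSnd f x₁ x₂) (fun y hy hyV => by
        rw [inner_neg_left, neg_nonneg]
        exact inner_gradient_nonpos_of_isMaxOn
          (convex_strategySet hC₂' L₂ _) (hasGradientAt_gradSnd hf x₁ x₂) hx₂ hmax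
          (mem_strategySet_iff.2 ⟨hy, hyV⟩)) hγ₀.le
    refine ⟨WithLp.toLp 2 (w₁, w₂), ?_⟩
    rw [map_neg, smul_neg] at hw₂'
    simp only [hJ, hD, WithLp.sub_fst, WithLp.sub_snd, WithLp.toLp_fst, WithLp.toLp_snd, hP₁, hP₂,
      hw₁, hw₂, add_sub_cancel, hw₁', hw₂']
  -- With `v = P p`, `s = 2v - p + Q r` equals `P p + Q (r - p)`, the partial inverse resolvent at
  -- `r`.
  have hstep : ∀ n, J (WithLp.toLp 2 (z₁ n, z₂ n) - D (WithLp.toLp 2 (z₁ n, z₂ n)))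
      = WithLp.toLp 2 (s₁ n, s₂ n) := by
    intro n
    have k₁ : z₁ n - γ • P₁ (gradFst f (e₁ + P₁ (z₁ n)) (e₂ + P₂ (z₂ n))) = r₁ n := by
      rw [hr₁, hg₁, hu₁, hu₂]
    have k₂ : z₂ n - -(γ • P₂ (gradSnd f (e₁ + P₁ (z₁ n)) (e₂ + P₂ (z₂ n)))) = r₂ n := by
      rw [hr₂, hg₂, hu₁, hu₂]; module
    simp only [hJ, hD, WithLp.sub_fst, WithLp.sub_snd, WithLp.toLp_fst, WithLp.toLp_snd, k₁, k₂]
    congr 2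
    · rw [partialInverseResolvent, ← hp₁, ← hP₁, hs₁, hv₁, map_sub]; module
    · rw [partialInverseResolvent, ← hp₂, ← hP₂, hs₂, hv₂, map_sub]; module
  have hupdate : ∀ n, WithLp.toLp 2 (z₁ (n + 1), z₂ (n + 1)) = WithLp.toLp 2 (z₁ n, z₂ n)
      + lam n • ((WithLp.toLp 2 (s₁ n, s₂ n) - D (WithLp.toLp 2 (s₁ n, s₂ n)))
        - (WithLp.toLp 2 (z₁ n, z₂ n) - D (WithLp.toLp 2 (z₁ n, z₂ n)))) := by
    intro n
    -- Hence the gradients taken at `e + v` in the second forward step are those of `D` at `s`.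
    have j₁ : P₁ (s₁ n) = v₁ n := by
      rw [hs₁, hv₁]
      simp only [map_add, map_sub, map_smul, hP₁, starProjection_starProjection_apply]; module
    have j₂ : P₂ (s₂ n) = v₂ n := by
      rw [hs₂, hv₂]
      simp only [map_add, map_sub, map_smul, hP₂, starProjection_starProjection_apply]; module
    simp only [hD, WithLp.toLp_fst, WithLp.toLp_snd, j₁, j₂, ← WithLp.toLp_sub, ← WithLp.toLp_add,
      ← WithLp.toLp_smul, Prod.mk_sub_mk, Prod.mk_add_mk, Prod.smul_mk]
    congr 2
    · rw [hz₁, ht₁, hr₁, hg₁, hh₁, hu₁, hu₂]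
    · rw [hz₂, ht₂, hr₂, hg₂, hh₂, hu₁, hu₂]; module
  obtain ⟨w, hw, hlim⟩ := exists_weak_limit_forward_backward_forward hJmono hDmono
    (by positivity) hκ hDlip hfix hε₀ hlam (z := fun n => WithLp.toLp 2 (z₁ n, z₂ n))
    (s := fun n => WithLp.toLp 2 (s₁ n, s₂ n)) (fun n => (hstep n).symm) hupdate
  have hlim₁ : WeaklyConverges z₁ w.fst := weaklyConverges_iff_tendsto_inner.2 fun y => by
    simpa using hlim (WithLp.toLp 2 (y, 0))
  have hlim₂ : WeaklyConverges z₂ w.snd := weaklyConverges_iff_tendsto_inner.2 fun y => by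
    simpa using hlim (WithLp.toLp 2 (0, y))
  obtain ⟨m₁, n₁⟩ := variational_of_partialInverseResolvent_eq (V := L₁.ker) (e := e₁)
    ⟨x₁, hx₁C⟩ hC₁ hC₁' (w := w.fst) (d := (D w).fst)
    (L₁.ker.smul_mem _ (L₁.ker.starProjection_apply_mem _)) (congrArg WithLp.fst hw)
  obtain ⟨m₂, n₂⟩ := variational_of_partialInverseResolvent_eq (V := L₂.ker) (e := e₂)
    ⟨x₂, hx₂C⟩ hC₂ hC₂' (w := w.snd) (d := (D w).snd)
    (L₂.ker.neg_mem (L₂.ker.smul_mem _ (L₂.ker.starProjection_apply_mem _)))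
    (congrArg WithLp.snd hw)
  refine ⟨P₁ w.fst + e₁, P₂ w.snd + e₂, w.fst, w.snd,
    ⟨mem_strategySet_iff.2 ⟨m₁, ?_⟩, mem_strategySet_iff.2 ⟨m₂, ?_⟩, ?_, ?_⟩, ?_, ?_, ?_, ?_,
    rfl, rfl⟩
  · rw [add_sub_cancel_right]; exact L₁.ker.starProjection_apply_mem _
  · rw [add_sub_cancel_right]; exact L₂.ker.starProjection_apply_mem _
  · refine isMinOn_iff.2 fun y hy => ?_
    obtain ⟨hyC, hyV⟩ := mem_strategySet_iff.1 hy
    have h := (hf_convex (P₂ w.snd + e₂)).add_inner_le_of_hasGradientAt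
      (hasGradientAt_gradFst hf (P₁ w.fst + e₁) (P₂ w.snd + e₂)) y
    -- Feasible displacements lie in `ker L₁`, so the projection in `D` can be dropped, and by
    -- convexity the first-order condition suffices for minimality.
    have hV : P₁ (y - (P₁ w.fst + e₁)) = y - (P₁ w.fst + e₁) := by
      refine L₁.ker.starProjection_eq_self_iff.2 ?_
      rw [← sub_sub, sub_right_comm]
      exact L₁.ker.sub_mem hyV (L₁.ker.starProjection_apply_mem _)
    have h' := n₁ y hyC hyV
    simp only [hD, WithLp.toLp_fst] at h'
    rw [real_inner_smul_left, hP₁, inner_starProjection_left_eq, ← hP₁, hV, add_comm e₁,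
      add_comm e₂, mul_nonneg_iff_of_pos_left hγ₀] at h'
    linarith
  · refine isMaxOn_iff.2 fun y hy => ?_
    obtain ⟨hyC, hyV⟩ := mem_strategySet_iff.1 hy
    have h := (hf_concave (P₁ w.fst + e₁)).le_add_inner_of_hasGradientAt
      (hasGradientAt_gradSnd hf (P₁ w.fst + e₁) (P₂ w.snd + e₂)) y
    have hV : P₂ (y - (P₂ w.snd + e₂)) = y - (P₂ w.snd + e₂) := by
      refine L₂.ker.starProjection_eq_self_iff.2 ?_
      rw [← sub_sub, sub_right_comm]
      exact L₂.ker.sub_mem hyV (L₂.ker.starProjection_apply_mem _)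
    have h' := n₂ y hyC hyV
    simp only [hD, WithLp.toLp_snd] at h'
    rw [inner_neg_left, real_inner_smul_left, hP₂, inner_starProjection_left_eq, ← hP₂, hV,
      add_comm e₁, add_comm e₂, neg_nonneg, mul_nonpos_iff_pos_imp_nonpos] at h'
    linarith [h'.1 hγ₀]
  · simp only [hu₁]; exact weaklyConverges_clm_add hlim₁ P₁ e₁
  · simp only [hu₂]; exact weaklyConverges_clm_add hlim₂ P₂ e₂
  · exact weaklyConverges_clm_add hlim₁ (ContinuousLinearMap.id ℝ H₁) e₁
  · exact weaklyConverges_clm_add hlim₂ (ContinuousLinearMap.id ℝ H₂) e₂
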